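/- **Setting.** A *linearizable (dartboard) sketch* has finitely many cells $c_0,\dots,c_{n-1}$ partitioning the unit square, with areas $p_0,\dots,p_{n-1}\ge 0$, $\sum_i p_i=1$, and a monotone function $\phi:\{0,1\}^*\to\{0,1\}$ (monotone in the coordinatewise order on strings of each fixed length). If $Z_i\in\{0,1\}$ indicates whether $c_i$ has been hit by a dart, then the state of the sketch is $\mathbf Y=(Y_0,\dots,Y_{n-1})$, where $$Y_i=Z_i\vee\phi(Y_0,\dots,Y_{i-1}).$$ The dartboard is poissonized: at cardinality $\lambda>0$ the numbers of darts in the cells are independent, Poisson with mean $p_i\lambda$ in $c_i$. Let $H(\lambda)$ be the Shannon entropy (in bits) of the state at cardinality $\lambda$, and let $P_\lambda$ be the probability of state change at cardinality $\lambda$: the conditional probability, given the current configuration, that one further dart, landing in $c_j$ with probability $p_j$, changes the state. Thus $P_\lambda$ is a random variable. Put $$H_0=\frac1{\ln 2}+\sum_{k=1}^\infty \frac{\log_2(1+1/k)}{k},\qquad I_0=\zeta(2)=\frac{\pi^2}{6},$$ and for $d>1$ $$x(d)=1-\max\bigl(8d^{-1/4},\,5e^{-d/2}\bigr),\qquad D(d)=1+\frac{344+4\sqrt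 d}{d}\,\frac{H_0}{I_0}\,x(d).$$ **Theorem.** Let $a<b$ be reals such that $d=b-a>1$ and $D(d)>0$, and let $\bar H,\bar R>0$. Suppose that a linearizable sketch satisfies 1. $H(\lambda)\le\bar H$ for all $\lambda>0$, and 2. $2\lambda\,\mathbb E(P_\lambda)\ge\bar R$ for all $\lambda\in[e^a,e^b]$. Then $$\frac{\bar H}{\bar R}\ \ge\ \frac{H_0}{2}\cdot\frac{x(d)}{D(d)} =\frac{H_0}{2}\cdot\frac{1-\max(8d^{-1/4},5e^{-d/2})}{1+\frac{344+4\sqrt d}{d}\frac{H_0}{I_0}\bigl(1-\max(8d^{-1/4},5e^{-d/2})\bigr)} .$$ Moreover $D(d)>0$ for every $d\ge 4096$, and the right-hand side tends to $H_0/2$ as $d\to\infty$, i.e. it equals $\frac{H_0}{2}(1-o_d(1))$. -/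

import Mathlib

open MeasureTheory ProbabilityTheory Filter Topology

noncomputable section

/-- A linearizable dartboard sketch with cells `c_0, …, c_{n-1}`, listed in the linear order in which
their statuses are encoded.  `area i` is the size of `c_i`; the cells partition the unit square.
`φ i` is the restriction to `{0,1}^i` of the monotone function `φ : {0,1}^* → {0,1}` that decides,
from the statuses of `c_0, …, c_{i-1}`, whether `c_i` is forced to be occupied. -/
structure LinearizableSketch (n : ℕ) where
  area : Fin n → ℝ
  area_nonneg : ∀ i, 0 ≤ area i
  area_sum : ∑ i, area i = 1
  φ : (i : ℕ) → (Fin i → Bool) → Bool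
  φ_mono : ∀ i, Monotone (φ i)

namespace LinearizableSketch

variable {n : ℕ} (S : LinearizableSketch n)

/-- The state `Y = (Y_0, …, Y_{n-1})` as a function of the hit indicators `Z = (Z_0, …, Z_{n-1})`:
`Y_i = Z_i ∨ φ (Y_0, …, Y_{i-1})`. -/
def state (z : Fin n → Bool) (i : Fin n) : Bool :=
  z i || S.φ i (fun j : Fin i => state z ⟨j, j.isLt.trans i.isLt⟩)
termination_by i.val
decreasing_by exact j.isLt

/-- The probability, over the position of the dart of one new element, that the state changes,
given that the cells hit so far are those with `z i = true`.  The new dart falls in `c_j` with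
probability `area j`. -/
def changeProb (z : Fin n → Bool) : ℝ :=
  ∑ j, if S.state (Function.update z j true) ≠ S.state z then S.area j else 0

/-- The law of the numbers of darts in the cells of the poissonized dartboard at cardinality `lam`:
independent Poisson variables, with mean `lam * area i` in cell `c_i`. -/
def dartLaw (lam : ℝ) : Measure (Fin n → ℕ) :=
  Measure.pi fun i => poissonMeasure (lam * S.area i).toNNReal

/-- The hit indicators: cell `c_i` is hit when it contains at least one dart. -/
def hit (N : Fin n → ℕ) (i : Fin n) : Bool := decide (0 < N i)

/-- Probability that the sketch is in state `s` at cardinality `lam`. -/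
def stateProb (lam : ℝ) (s : Fin n → Bool) : ℝ :=
  (S.dartLaw lam).real {N | S.state (hit N) = s}

/-- Shannon entropy `H(lam)`, in bits, of the state at cardinality `lam`. -/
def entropy (lam : ℝ) : ℝ :=
  ∑ s : Fin n → Bool, -(S.stateProb lam s * Real.logb 2 (S.stateProb lam s))

/-- `E(P_lam)`, the expectation of the (random) probability of state change at cardinality `lam`. -/
def expectedChangeProb (lam : ℝ) : ℝ :=
  ∫ N, S.changeProb (hit N) ∂(S.dartLaw lam)

end LinearizableSketch

/-- `H₀ = 1 / ln 2 + ∑_{k ≥ 1} k⁻¹ log₂ (1 + 1/k)`. -/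
def constH0 : ℝ :=
  (Real.log 2)⁻¹ + ∑' k : ℕ, ((k : ℝ) + 1)⁻¹ * Real.logb 2 (1 + 1 / ((k : ℝ) + 1))

/-- `I₀ = ζ(2) = π² / 6`. -/
def constI0 : ℝ := Real.pi ^ 2 / 6

/-- `1 - max (8 d^{-1/4}, 5 e^{-d/2})`. -/
def coreNumer (d : ℝ) : ℝ :=
  1 - max (8 * d ^ (-(1 / 4) : ℝ)) (5 * Real.exp (-d / 2))

/-- `1 + ((344 + 4 √d) / d) (H₀ / I₀) (1 - max (8 d^{-1/4}, 5 e^{-d/2}))`. -/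
def coreDenom (d : ℝ) : ℝ :=
  1 + (344 + 4 * √d) / d * (constH0 / constI0) * coreNumer d

end

/-! The hit bits are independent. Call a cell free if the earlier cells do not force it; freeness
depends only on earlier bits, hence is independent of the cell's own bit. With `f_i(λ)` the
probability that cell `i` is free, `E P_λ = ∑ p_i e^{-λ p_i} f_i(λ)`, and the chain rule gives `H(λ)
= ∑ f_i(λ) h(e^{-λ p_i})` with `h` the binary entropy (`expectedChangeProb_eq`, `entropy_eq`).
Monotonicity of `φ` makes each `f_i` antitone.

Integrate `H(λ)` and `λ E P_λ` against `dλ/λ` and put `x = p_i λ`. A cell contributes `∫ g e^{-x}`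
to the rate and, in nats, `∫ g (e^{-x} + hitEntropy x)` to the entropy, with the same antitone `g`.
On `(0, ∞)` the unweighted masses are `1` and `1 + logSeries = H₀ ln 2` (`integral_hitEntropy`).
Since `hitEntropy x * e^x` is antitone, `hitEntropy` sits further left than `e^{-x}`, so an antitone
weight can only favour it.

A finite window cuts off mass near `0`. Extending the entropy window to the left by `K` on the
logarithmic scale reduces this loss to `12 / K` (`integral_cell_le`) and lengthens the window from
`d` to `d + K`; `K = √d` balances the two costs (`core_bound`). -/

noncomputable section

/-! ### Expectations over independent bits -/

/-- The weight of the outcome `b` of a bit that is `false` with probability `q`. -/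
def bitWeight (q : ℝ) (b : Bool) : ℝ := if b then 1 - q else q

/-- The expectation of `F` over independent bits, the `i`-th of which is `false` with
probability `q i`. -/
def bitExp {n : ℕ} (q : Fin n → ℝ) (F : (Fin n → Bool) → ℝ) : ℝ :=
  ∑ z, (∏ i, bitWeight (q i) (z i)) * F z

theorem bitWeight_nonneg {q : ℝ} (h0 : 0 ≤ q) (h1 : q ≤ 1) (b : Bool) : 0 ≤ bitWeight q b := by
  cases b <;> simp [bitWeight] <;> linarith

theorem bitExp_mono {n : ℕ} {q : Fin n → ℝ} (h0 : ∀ i, 0 ≤ q i) (h1 : ∀ i, q i ≤ 1)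
    {F G : (Fin n → Bool) → ℝ} (h : ∀ z, F z ≤ G z) : bitExp q F ≤ bitExp q G :=
  Finset.sum_le_sum fun z _ => mul_le_mul_of_nonneg_left (h z)
    (Finset.prod_nonneg fun i _ => bitWeight_nonneg (h0 i) (h1 i) _)

theorem bitExp_succ {n : ℕ} (q : Fin (n + 1) → ℝ) (F : (Fin (n + 1) → Bool) → ℝ) :
    bitExp q F = q 0 * bitExp (fun i => q i.succ) (fun z => F (Fin.cons false z)) +
      (1 - q 0) * bitExp (fun i => q i.succ) (fun z => F (Fin.cons true z)) := by
  unfold bitExp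
  rw [← (Fin.consEquiv fun _ => Bool).sum_comp, Fintype.sum_prod_type]
  simp [Fin.consEquiv, Fin.prod_univ_succ, bitWeight, Finset.mul_sum, mul_assoc, add_comm]

/-- The expectation of an antitone function increases with the probabilities of `false`. -/
theorem bitExp_le_of_antitone {n : ℕ} {q q' : Fin n → ℝ} (h0 : ∀ i, 0 ≤ q i)
    (hq : ∀ i, q i ≤ q' i) (h1 : ∀ i, q' i ≤ 1) {F : (Fin n → Bool) → ℝ} (hF : Antitone F) :
    bitExp q F ≤ bitExp q' F := by
  induction n with
  | zero => simp [bitExp]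
  | succ n ih =>
    rw [bitExp_succ, bitExp_succ]
    have hm : ∀ b : Bool, Antitone fun z : Fin n → Bool => F (Fin.cons b z) := fun b x y hxy =>
      hF (Fin.cons_le_cons.2 ⟨le_rfl, hxy⟩)
    have hf := ih (fun i => h0 i.succ) (fun i => hq i.succ) (fun i => h1 i.succ) (hm false)
    have ht := ih (fun i => h0 i.succ) (fun i => hq i.succ) (fun i => h1 i.succ) (hm true)
    have hc : bitExp (fun i => q' i.succ) (fun z => F (Fin.cons true z)) ≤
        bitExp (fun i => q' i.succ) (fun z => F (Fin.cons false z)) :=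
      bitExp_mono (fun i => (h0 _).trans (hq _)) (fun i => h1 _) fun z =>
        hF (Fin.cons_le_cons.2 ⟨Bool.false_le _, le_rfl⟩)
    -- With `f, t` the two conditional expectations and `f', t'` those for `q'`, the difference is
    -- `q₀ (f' - f) + (1 - q₀) (t' - t) + (q'₀ - q₀) (f' - t')`.
    nlinarith [h0 0, hq 0, h1 0, mul_le_mul_of_nonneg_left hf (h0 0),
      mul_le_mul_of_nonneg_left ht (sub_nonneg.2 ((hq 0).trans (h1 0))),
      mul_nonneg (sub_nonneg.2 (hq 0)) (sub_nonneg.2 hc)]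

/-- A bit is independent of a function of the others. -/
theorem bitExp_mul {n : ℕ} (q : Fin n → ℝ) (i : Fin n) (F : (Fin n → Bool) → ℝ)
    (hF : ∀ z b, F (Function.update z i b) = F z) (G : Bool → ℝ) :
    bitExp q (fun z => F z * G (z i)) = bitExp q F * (q i * G false + (1 - q i) * G true) := by
  have key : ∀ G : Bool → ℝ, bitExp q (fun z => F z * G (z i)) =
      (∑ y : {j // j ≠ i} → Bool, (∏ j : {j // j ≠ i}, bitWeight (q j) (y j)) *
        F ((Equiv.funSplitAt i Bool).symm (false, y))) * (q i * G false + (1 - q i) * G true) := by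
    intro G
    unfold bitExp
    rw [← (Equiv.funSplitAt i Bool).symm.sum_comp, Fintype.sum_prod_type_right, Finset.sum_mul]
    refine Finset.sum_congr rfl fun y _ => ?_
    have hw : ∀ b, ∏ j, bitWeight (q j) ((Equiv.funSplitAt i Bool).symm (b, y) j) =
        bitWeight (q i) b * ∏ j : {j // j ≠ i}, bitWeight (q j) (y j) := by
      intro b
      rw [Fintype.prod_eq_mul_prod_subtype_ne _ i]
      congr 1
      · simp [Equiv.funSplitAt]
      · exact Finset.prod_congr rfl fun j _ => by simp [Equiv.funSplitAt, j.2]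
    have hF' : F ((Equiv.funSplitAt i Bool).symm (true, y)) =
        F ((Equiv.funSplitAt i Bool).symm (false, y)) := by
      rw [← hF _ false]
      congr 1
      ext j
      by_cases hj : j = i
      · subst hj; simp [Equiv.funSplitAt]
      · simp [Equiv.funSplitAt, hj]
    have hi : ∀ b, (Equiv.funSplitAt i Bool).symm (b, y) i = b := by
      intro b; simp [Equiv.funSplitAt]
    simp only [Fintype.sum_bool, hw, hF', hi]
    simp only [bitWeight, if_true, Bool.false_eq_true, if_false]
    ring
  -- The constant `G = 1` identifies the sum over the other bits with `bitExp q F`.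
  have h1 := key fun _ => 1
  simp only [mul_one] at h1
  rw [key, h1]
  ring

/-! ### States, forced cells and free cells -/

namespace LinearizableSketch

variable {n : ℕ} (S : LinearizableSketch n)

/-- Whether `φ` forces cell `i` to be occupied in the state `s`. -/
def forced (s : Fin n → Bool) (i : Fin n) : Bool :=
  S.φ i fun j : Fin i => s ⟨j, j.isLt.trans i.isLt⟩

theorem state_apply (z : Fin n → Bool) (i : Fin n) :
    S.state z i = (z i || S.forced (S.state z) i) := by
  rw [state]; rfl

/-- The recursion is triangular, so it has only one solution. The criterion splits into one
condition per bit of `z`, so the fibres of `state` are boxes. -/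
theorem state_eq_iff (z s : Fin n → Bool) :
    S.state z = s ↔ ∀ i, (z i || S.forced s i) = s i := by
  constructor
  · rintro rfl i
    exact (S.state_apply z i).symm
  · intro h
    have : ∀ k (hk : k < n), S.state z ⟨k, hk⟩ = s ⟨k, hk⟩ := by
      intro k
      induction k using Nat.strong_induction_on with
      | _ k ih =>
        intro hk
        rw [S.state_apply, ← h]
        exact congrArg (z ⟨k, hk⟩ || ·) (congrArg (S.φ k) (funext fun j : Fin k => ih j j.isLt _))
    exact funext fun i => this i i.2

theorem state_mono : Monotone S.state := by
  intro z z' hz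
  have : ∀ k (hk : k < n), S.state z ⟨k, hk⟩ ≤ S.state z' ⟨k, hk⟩ := by
    intro k
    induction k using Nat.strong_induction_on with
    | _ k ih =>
      intro hk
      rw [S.state_apply, S.state_apply]
      exact sup_le_sup (hz _) (S.φ_mono _ fun j => ih j j.isLt _)
  exact fun i => this i i.2

theorem state_update_of_lt (z : Fin n → Bool) (i : Fin n) (b : Bool) (j : Fin n) (hj : j < i) :
    S.state (Function.update z i b) j = S.state z j := by
  have : ∀ k (hk : k < n), k < i.val →
      S.state (Function.update z i b) ⟨k, hk⟩ = S.state z ⟨k, hk⟩ := by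
    intro k
    induction k using Nat.strong_induction_on with
    | _ k ih =>
      intro hk hki
      rw [S.state_apply, S.state_apply, Function.update_of_ne (Fin.ne_of_val_ne hki.ne)]
      exact congrArg (z ⟨k, hk⟩ || ·)
        (congrArg (S.φ k) (funext fun j : Fin k => ih j j.isLt _ (j.isLt.trans hki)))
  exact this j j.2 hj

theorem forced_state_update (z : Fin n → Bool) (i : Fin n) (b : Bool) :
    S.forced (S.state (Function.update z i b)) i = S.forced (S.state z) i := by
  unfold forced
  congr 1
  exact funext fun j => S.state_update_of_lt z i b _ j.isLt

/-- A new dart in cell `j` changes the state iff the cell is neither hit nor forced. -/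
theorem state_update_ne_iff (z : Fin n → Bool) (j : Fin n) :
    S.state (Function.update z j true) ≠ S.state z ↔
      S.forced (S.state z) j = false ∧ z j = false := by
  constructor
  · intro h
    by_contra hc
    apply h
    rw [S.state_eq_iff]
    intro i
    rw [S.state_apply z i]
    by_cases hi : i = j
    · subst hi
      rcases hz : z i <;> rcases hf : S.forced (S.state z) i <;> simp_all
    · rw [Function.update_of_ne hi]
  · rintro ⟨h1, h2⟩ h
    have := congrFun h j
    rw [S.state_apply, S.state_apply z, h1, h2] at this
    simp at this

/-- The probability that cell `i` is missed at cardinality `lam`. -/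
def miss (lam : ℝ) (i : Fin n) : ℝ := Real.exp (-(lam * S.area i))

/-- The indicator that cell `i` is not forced, in terms of the hit indicators. -/
def freeInd (i : Fin n) (z : Fin n → Bool) : ℝ := if S.forced (S.state z) i then 0 else 1

/-- The probability that cell `i` is not forced at cardinality `lam`. -/
def freeProb (i : Fin n) (lam : ℝ) : ℝ := bitExp (S.miss lam) (S.freeInd i)

theorem miss_pos (lam : ℝ) (i : Fin n) : 0 < S.miss lam i := Real.exp_pos _

theorem miss_le_one {lam : ℝ} (h : 0 ≤ lam) (i : Fin n) : S.miss lam i ≤ 1 :=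
  Real.exp_le_one_iff.2 (neg_nonpos.2 (mul_nonneg h (S.area_nonneg i)))

theorem freeInd_nonneg (i : Fin n) (z : Fin n → Bool) : 0 ≤ S.freeInd i z := by
  unfold freeInd; split_ifs <;> norm_num

/-- This is what linearizability buys: freeness of a cell is independent of its own hit bit. -/
theorem freeInd_update (i : Fin n) (z : Fin n → Bool) (b : Bool) :
    S.freeInd i (Function.update z i b) = S.freeInd i z := by
  rw [freeInd, freeInd, forced_state_update]

theorem freeInd_antitone (i : Fin n) : Antitone (S.freeInd i) := by
  intro z z' h
  have hf : S.forced (S.state z) i ≤ S.forced (S.state z') i :=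
    S.φ_mono _ fun j => S.state_mono h _
  unfold freeInd
  rcases h1 : S.forced (S.state z) i <;> rcases h2 : S.forced (S.state z') i <;>
    simp only [h1, h2] at hf ⊢ <;> revert hf <;> simp

theorem freeProb_nonneg (i : Fin n) {lam : ℝ} (h : 0 ≤ lam) : 0 ≤ S.freeProb i lam :=
  Finset.sum_nonneg fun _ _ => mul_nonneg (Finset.prod_nonneg fun _ _ =>
    bitWeight_nonneg (S.miss_pos _ _).le (S.miss_le_one h _) _) (S.freeInd_nonneg _ _)

theorem freeProb_antitoneOn (i : Fin n) : AntitoneOn (S.freeProb i) (Set.Ici 0) := by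
  intro x hx y hy hxy
  refine bitExp_le_of_antitone (fun j => (S.miss_pos _ _).le) (fun j => ?_)
    (fun j => S.miss_le_one hx j) (S.freeInd_antitone i)
  exact Real.exp_le_exp.2 (neg_le_neg (mul_le_mul_of_nonneg_right hxy (S.area_nonneg j)))

theorem continuous_freeProb (i : Fin n) : Continuous (S.freeProb i) := by
  unfold freeProb bitExp
  refine continuous_finsetSum _ fun z _ => Continuous.mul ?_ continuous_const
  refine continuous_finsetProd _ fun j _ => ?_
  unfold bitWeight miss
  split_ifs <;> fun_prop

/-! ### The Poisson law as independent bits -/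

theorem measurable_hit : Measurable (hit : (Fin n → ℕ) → Fin n → Bool) :=
  measurable_pi_iff.2 fun i =>
    (measurable_of_countable fun k : ℕ => decide (0 < k)).comp (measurable_pi_apply i)

instance (lam : ℝ) : IsProbabilityMeasure (S.dartLaw lam) := by
  unfold dartLaw; infer_instance

theorem poissonMeasure_real_zero (r : NNReal) :
    (poissonMeasure r).real {0} = Real.exp (-r) := by
  simp [poissonMeasure_real_singleton]

theorem dartLaw_hit_eq {lam : ℝ} (hlam : 0 ≤ lam) (z : Fin n → Bool) :
    (S.dartLaw lam).real (hit ⁻¹' {z}) = ∏ i, bitWeight (S.miss lam i) (z i) := by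
  have hset : (hit ⁻¹' {z} : Set (Fin n → ℕ)) =
      Set.univ.pi fun i => if z i then ({0}ᶜ : Set ℕ) else {0} := by
    ext N
    simp only [Set.mem_preimage, Set.mem_singleton_iff, Set.mem_univ_pi, funext_iff]
    refine forall_congr' fun i => ?_
    rcases hz : z i <;> simp [hit, Nat.pos_iff_ne_zero]
  rw [hset, dartLaw, measureReal_def, Measure.pi_pi, ENNReal.toReal_prod]
  refine Finset.prod_congr rfl fun i _ => ?_
  rw [← measureReal_def]
  have h0 : (poissonMeasure (lam * S.area i).toNNReal).real {0} = S.miss lam i := by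
    rw [poissonMeasure_real_zero, Real.coe_toNNReal _ (mul_nonneg hlam (S.area_nonneg i)), miss]
  rcases hz : z i
  · simpa [bitWeight] using h0
  · simp only [bitWeight, if_true]
    rw [probReal_compl_eq_one_sub (measurableSet_singleton 0), h0]

theorem integral_dartLaw {lam : ℝ} (hlam : 0 ≤ lam) (F : (Fin n → Bool) → ℝ) :
    ∫ N, F (hit N) ∂(S.dartLaw lam) = bitExp (S.miss lam) F := by
  have : IsProbabilityMeasure ((S.dartLaw lam).map hit) :=
    Measure.isProbabilityMeasure_map measurable_hit.aemeasurable
  rw [← integral_map (φ := hit) measurable_hit.aemeasurable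
    (measurable_of_countable F).aestronglyMeasurable,
    integral_fintype (Integrable.of_finite)]
  refine Finset.sum_congr rfl fun z _ => ?_
  rw [map_measureReal_apply measurable_hit (measurableSet_singleton z), S.dartLaw_hit_eq hlam,
    smul_eq_mul]

theorem stateProb_eq {lam : ℝ} (hlam : 0 ≤ lam) (s : Fin n → Bool) :
    S.stateProb lam s = bitExp (S.miss lam) (fun z => if S.state z = s then 1 else 0) := by
  have hm : MeasurableSet {N : Fin n → ℕ | S.state (hit N) = s} :=
    measurable_hit (Set.toFinite {z | S.state z = s}).measurableSet
  rw [← S.integral_dartLaw hlam, stateProb, ← integral_indicator_one hm]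
  refine integral_congr_ae (Eventually.of_forall fun N => ?_)
  simp [Set.indicator_apply]

/-- A dart in a cell changes the state exactly when the cell is free and missed, two independent
events. -/
theorem expectedChangeProb_eq {lam : ℝ} (hlam : 0 ≤ lam) :
    S.expectedChangeProb lam = ∑ i, S.area i * S.miss lam i * S.freeProb i lam := by
  rw [expectedChangeProb, S.integral_dartLaw hlam]
  have h : S.changeProb = fun z => ∑ j, S.area j * (S.freeInd j z * (if z j then 0 else 1)) := by
    funext z
    refine Finset.sum_congr rfl fun j _ => ?_
    simp only [S.state_update_ne_iff, freeInd]
    rcases h1 : S.forced (S.state z) j <;> rcases h2 : z j <;> simp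
  have h2 : bitExp (S.miss lam) S.changeProb = ∑ j, S.area j *
      bitExp (S.miss lam) (fun z => S.freeInd j z * (if z j then 0 else 1)) := by
    rw [h]
    simp only [bitExp, Finset.mul_sum]
    rw [Finset.sum_comm]
    exact Finset.sum_congr rfl fun _ _ => Finset.sum_congr rfl fun _ _ => by ring
  rw [h2]
  refine Finset.sum_congr rfl fun j _ => ?_
  rw [bitExp_mul _ j (S.freeInd j) (S.freeInd_update j) fun b => if b then 0 else 1, freeProb]
  simp only [if_true, Bool.false_eq_true, if_false]
  ring

/-! ### Chain rule for the entropy -/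

/-- The conditional probability of the `i`-th bit of `s`, given the previous ones. -/
def condWeight (lam : ℝ) (s : Fin n → Bool) (i : Fin n) : ℝ :=
  ∑ b, if (b || S.forced s i) = s i then bitWeight (S.miss lam i) b else 0

theorem stateProb_eq_prod {lam : ℝ} (hlam : 0 ≤ lam) (s : Fin n → Bool) :
    S.stateProb lam s = ∏ i, S.condWeight lam s i := by
  rw [S.stateProb_eq hlam]
  unfold condWeight bitExp
  rw [Finset.prod_univ_sum, Fintype.piFinset_univ]
  refine Finset.sum_congr rfl fun z _ => ?_
  simp only [S.state_eq_iff]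
  split_ifs with h
  · rw [mul_one]
    exact Finset.prod_congr rfl fun i _ => (if_pos (h i)).symm
  · push Not at h
    obtain ⟨i, hi⟩ := h
    rw [mul_zero, Finset.prod_eq_zero (Finset.mem_univ i) (if_neg hi)]

/-- A forced bit is certain, so its logarithm vanishes; a free bit reproduces the hit bit. -/
theorem log_condWeight (lam : ℝ) (z : Fin n → Bool) (i : Fin n) :
    Real.log (S.condWeight lam (S.state z) i) =
      S.freeInd i z * Real.log (bitWeight (S.miss lam i) (z i)) := by
  unfold condWeight freeInd
  have := S.state_apply z i
  rcases h1 : S.forced (S.state z) i <;> rcases h2 : z i <;> simp [this, h1, h2, bitWeight]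

/-- The entropy is the expectation of `-log` of the probability of the realized state. The product
formula turns the logarithm into a sum over cells, and freeness factors out of each term by
independence. -/
theorem entropy_eq {lam : ℝ} (hlam : 0 ≤ lam) :
    S.entropy lam = (∑ i, S.freeProb i lam * -(S.miss lam i * Real.log (S.miss lam i) +
      (1 - S.miss lam i) * Real.log (1 - S.miss lam i))) / Real.log 2 := by
  have h1 : S.entropy lam =
      -bitExp (S.miss lam) (fun z => Real.log (S.stateProb lam (S.state z))) / Real.log 2 := by
    have : ∀ s, -(S.stateProb lam s * Real.logb 2 (S.stateProb lam s)) =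
        -(∑ z, (∏ i, bitWeight (S.miss lam i) (z i)) *
          (if S.state z = s then Real.log (S.stateProb lam (S.state z)) else 0)) / Real.log 2 := by
      intro s
      nth_rewrite 1 [S.stateProb_eq hlam]
      rw [bitExp, Real.logb, ← neg_mul, mul_div_assoc', neg_mul, Finset.sum_mul]
      congr 3
      funext z
      split_ifs with h
      · rw [h]; ring
      · ring
    simp only [entropy, this]
    rw [← Finset.sum_div, Finset.sum_neg_distrib, Finset.sum_comm]
    congr 2
    refine Finset.sum_congr rfl fun z _ => ?_
    rw [← Finset.mul_sum, Finset.sum_ite_eq Finset.univ (S.state z)]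
    simp
  have h2 : bitExp (S.miss lam) (fun z => Real.log (S.stateProb lam (S.state z))) =
      ∑ i, bitExp (S.miss lam)
        (fun z => S.freeInd i z * Real.log (bitWeight (S.miss lam i) (z i))) := by
    unfold bitExp
    rw [Finset.sum_comm]
    refine Finset.sum_congr rfl fun z _ => ?_
    rw [← Finset.mul_sum]
    -- Outcomes of weight zero drop out; for the others the state has positive probability, so no
    -- factor vanishes and the logarithm splits.
    by_cases hz : ∏ i, bitWeight (S.miss lam i) (z i) = 0
    · simp [hz]
    congr 1
    have hw : ∀ z : Fin n → Bool, 0 ≤ ∏ i, bitWeight (S.miss lam i) (z i) := fun z =>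
      Finset.prod_nonneg fun _ _ => bitWeight_nonneg (S.miss_pos _ _).le (S.miss_le_one hlam _) _
    have hpos : 0 < S.stateProb lam (S.state z) := by
      rw [S.stateProb_eq hlam]
      refine Finset.sum_pos' (fun y _ => mul_nonneg (hw y) (by dsimp only; split_ifs <;> norm_num))
        ⟨z, Finset.mem_univ _, ?_⟩
      simpa using lt_of_le_of_ne (hw z) (Ne.symm hz)
    dsimp only
    rw [S.stateProb_eq_prod hlam] at hpos ⊢
    rw [Real.log_prod fun i hi => Finset.prod_ne_zero_iff.1 hpos.ne' i hi]
    exact Finset.sum_congr rfl fun i _ => S.log_condWeight lam z i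
  rw [h1, h2, ← Finset.sum_neg_distrib]
  congr 1
  refine Finset.sum_congr rfl fun i _ => ?_
  rw [bitExp_mul _ i (S.freeInd i) (S.freeInd_update i)
    fun b => Real.log (bitWeight (S.miss lam i) b), freeProb]
  simp only [bitWeight, if_true, Bool.false_eq_true, if_false]
  ring

end LinearizableSketch

/-! ### The function `hitEntropy` and its integral -/

/-- The slope `(1 - e^{-x}) / x`. -/
def expSlope (x : ℝ) : ℝ := (1 - Real.exp (-x)) / x

/-- The part of the entropy, in nats and per unit of `x`, of a Bernoulli variable with parameter
`1 - e^{-x}` that comes from the outcome of probability `1 - e^{-x}`. -/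
def hitEntropy (x : ℝ) : ℝ := expSlope x * -Real.log (1 - Real.exp (-x))

theorem exp_neg_lt_one {x : ℝ} (hx : 0 < x) : Real.exp (-x) < 1 :=
  Real.exp_zero ▸ Real.exp_lt_exp.2 (neg_lt_zero.2 hx)

theorem expSlope_pos {x : ℝ} (hx : 0 < x) : 0 < expSlope x :=
  div_pos (sub_pos.2 (exp_neg_lt_one hx)) hx

theorem expSlope_le_one {x : ℝ} (hx : 0 < x) : expSlope x ≤ 1 :=
  (div_le_one hx).2 (by linarith [Real.add_one_le_exp (-x)])

theorem neg_log_one_sub_exp_pos {x : ℝ} (hx : 0 < x) : 0 < -Real.log (1 - Real.exp (-x)) :=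
  neg_pos.2 (Real.log_neg (sub_pos.2 (exp_neg_lt_one hx)) (by linarith [Real.exp_pos (-x)]))

theorem hitEntropy_pos {x : ℝ} (hx : 0 < x) : 0 < hitEntropy x :=
  mul_pos (expSlope_pos hx) (neg_log_one_sub_exp_pos hx)

/-- It is the secant slope of the convex function `exp` between `-x` and `0`. -/
theorem expSlope_antitoneOn : AntitoneOn expSlope (Set.Ioi 0) := by
  intro x hx y hy hxy
  have h := convexOn_exp.secant_mono (Set.mem_univ 0) (Set.mem_univ (-y)) (Set.mem_univ (-x))
    (neg_ne_zero.2 (ne_of_gt hy)) (neg_ne_zero.2 (ne_of_gt hx)) (neg_le_neg hxy)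
  have e : ∀ t, (Real.exp (-t) - Real.exp 0) / (-t - 0) = expSlope t := by
    intro t
    rw [expSlope, Real.exp_zero, sub_zero, ← neg_sub, neg_div_neg_eq]
  rwa [e, e] at h

theorem continuousOn_expSlope : ContinuousOn expSlope (Set.Ioi 0) :=
  ContinuousOn.div (by fun_prop) continuousOn_id fun _ hx => ne_of_gt hx

theorem continuousOn_hitEntropy : ContinuousOn hitEntropy (Set.Ioi 0) := by
  refine continuousOn_expSlope.mul (ContinuousOn.neg (ContinuousOn.log (by fun_prop) ?_))
  exact fun x hx => (sub_pos.2 (exp_neg_lt_one hx)).ne'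

/-- `hitEntropy x * exp x = expSlope x / expSlope (-log (1 - exp (-x)))` is antitone. -/
theorem hitEntropy_mul_exp_antitoneOn :
    AntitoneOn (fun x => hitEntropy x * Real.exp x) (Set.Ioi 0) := by
  have e : ∀ x : ℝ, 0 < x → hitEntropy x * Real.exp x =
      expSlope x * (expSlope (-Real.log (1 - Real.exp (-x))))⁻¹ := by
    intro x hx
    rw [hitEntropy, expSlope.eq_1 (-Real.log _), neg_neg,
      Real.exp_log (sub_pos.2 (exp_neg_lt_one hx)), sub_sub_cancel, inv_div, Real.exp_neg,
      div_inv_eq_mul, mul_assoc]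
  intro x hx y hy hxy
  have hx' : 0 < x := hx
  have hy' : 0 < y := hy
  simp only
  rw [e x hx', e y hy']
  -- The map `x ↦ -log (1 - e^{-x})` is decreasing, so `expSlope` of it increases and the inverse of
  -- that decreases, like the first factor.
  have h1 : -Real.log (1 - Real.exp (-y)) ≤ -Real.log (1 - Real.exp (-x)) :=
    neg_le_neg (Real.log_le_log (sub_pos.2 (exp_neg_lt_one hx'))
      (sub_le_sub_left (Real.exp_le_exp.2 (neg_le_neg hxy)) 1))
  exact mul_le_mul (expSlope_antitoneOn hx hy hxy)
    (inv_anti₀ (expSlope_pos (neg_log_one_sub_exp_pos hx'))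
      (expSlope_antitoneOn (neg_log_one_sub_exp_pos hy') (neg_log_one_sub_exp_pos hx') h1))
    (inv_nonneg.2 (expSlope_pos (neg_log_one_sub_exp_pos hy')).le) (expSlope_pos hx').le

/-- The series `∑ k⁻¹ log (1 + 1/k)` over `k ≥ 1`. -/
def logSeries : ℝ := ∑' k : ℕ, ((k : ℝ) + 1)⁻¹ * Real.log (1 + 1 / ((k : ℝ) + 1))

theorem logSeries_term_nonneg (k : ℕ) :
    0 ≤ ((k : ℝ) + 1)⁻¹ * Real.log (1 + 1 / ((k : ℝ) + 1)) :=
  mul_nonneg (by positivity) (Real.log_nonneg (le_add_of_nonneg_right (by positivity)))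

theorem logSeries_term_le (k : ℕ) :
    ((k : ℝ) + 1)⁻¹ * Real.log (1 + 1 / ((k : ℝ) + 1)) ≤ 1 / ((k + 1 : ℕ) : ℝ) ^ 2 := by
  have h : Real.log (1 + 1 / ((k : ℝ) + 1)) ≤ 1 / ((k : ℝ) + 1) := by
    have := Real.log_le_sub_one_of_pos (show (0 : ℝ) < 1 + 1 / ((k : ℝ) + 1) by positivity)
    linarith
  calc _ ≤ ((k : ℝ) + 1)⁻¹ * (1 / ((k : ℝ) + 1)) := mul_le_mul_of_nonneg_left h (by positivity)
    _ = _ := by push_cast; field_simp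

theorem summable_inv_sq : Summable fun k : ℕ => 1 / ((k + 1 : ℕ) : ℝ) ^ 2 :=
  (summable_nat_add_iff 1).2 hasSum_zeta_two.summable

theorem summable_logSeries :
    Summable fun k : ℕ => ((k : ℝ) + 1)⁻¹ * Real.log (1 + 1 / ((k : ℝ) + 1)) :=
  Summable.of_nonneg_of_le logSeries_term_nonneg logSeries_term_le summable_inv_sq

theorem logSeries_pos : 0 < logSeries :=
  summable_logSeries.tsum_pos logSeries_term_nonneg 0 (by simpa using Real.log_pos (by norm_num))

theorem logSeries_le : logSeries ≤ 5 := by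
  have h1 : logSeries ≤ ∑' k : ℕ, 1 / ((k + 1 : ℕ) : ℝ) ^ 2 :=
    summable_logSeries.tsum_le_tsum logSeries_term_le summable_inv_sq
  have h2 := hasSum_zeta_two.summable.sum_add_tsum_nat_add 1
  rw [hasSum_zeta_two.tsum_eq] at h2
  simp at h1 h2
  nlinarith [Real.pi_le_four, Real.pi_pos]

/-- The integrand is `(e^{-(k+1)x} - e^{-(k+2)x}) / x`, a Frullani integral with value `log
((k+2)/(k+1))`. -/
theorem integral_exp_neg_mul_expSlope (k : ℕ) :
    IntegrableOn (fun x => expSlope x * Real.exp (-((k : ℝ) + 1) * x)) (Set.Ioi 0) ∧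
    ∫ x in Set.Ioi 0, expSlope x * Real.exp (-((k : ℝ) + 1) * x) =
      Real.log (1 + 1 / ((k : ℝ) + 1)) := by
  have hk : (0 : ℝ) < k + 1 := by positivity
  have hint : IntegrableOn (fun x => expSlope x * Real.exp (-((k : ℝ) + 1) * x)) (Set.Ioi 0) := by
    refine Integrable.mono' (exp_neg_integrableOn_Ioi 0 hk)
      ((continuousOn_expSlope.mul (by fun_prop)).aestronglyMeasurable measurableSet_Ioi) ?_
    filter_upwards [ae_restrict_mem measurableSet_Ioi] with x hx
    rw [Real.norm_of_nonneg (mul_nonneg (expSlope_pos hx).le (Real.exp_pos _).le)]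
    exact mul_le_of_le_one_left (Real.exp_pos _).le (expSlope_le_one hx)
  refine ⟨hint, ?_⟩
  have e : (fun x => expSlope x * Real.exp (-((k : ℝ) + 1) * x)) = fun x : ℝ => x⁻¹ •
      ((fun t => Real.exp (-t)) (((k : ℝ) + 1) * x) - (fun t => Real.exp (-t)) ((k + 2) * x)) := by
    funext x
    have : Real.exp (-((k + 2) * x)) = Real.exp (-x) * Real.exp (-((k : ℝ) + 1) * x) := by
      rw [← Real.exp_add]; ring_nf
    simp only [this, smul_eq_mul, expSlope, neg_mul]
    ring
  rw [e] at hint ⊢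
  have hc : Continuous fun t : ℝ => Real.exp (-t) := by fun_prop
  rw [Frullani.integral_Ioi_eq (L := 1) (R := 0)
    (hc.continuousOn.locallyIntegrableOn measurableSet_Ioi) hk (by positivity) ?_ ?_ hint]
  · rw [sub_zero, smul_eq_mul, mul_one]
    congr 1
    field_simp
    ring
  · have := hc.tendsto 0
    rw [neg_zero, Real.exp_zero] at this
    exact this.mono_left nhdsWithin_le_nhds
  · exact Real.tendsto_exp_neg_atTop_nhds_zero

/-- Expand `-log (1 - e^{-x}) = ∑ e^{-(k+1)x} / (k+1)` and integrate the nonnegative terms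
separately. -/
theorem integral_hitEntropy : ∫ x in Set.Ioi 0, hitEntropy x = logSeries := by
  set F : ℕ → ℝ → ℝ := fun k x => ((k : ℝ) + 1)⁻¹ * (expSlope x * Real.exp (-((k : ℝ) + 1) * x))
    with hF
  have hFi : ∀ k, ∫ x in Set.Ioi 0, F k x =
      ((k : ℝ) + 1)⁻¹ * Real.log (1 + 1 / ((k : ℝ) + 1)) := fun k => by
    rw [hF, integral_const_mul, (integral_exp_neg_mul_expSlope k).2]
  have hn : ∀ k, ∫ x in Set.Ioi 0, ‖F k x‖ = ∫ x in Set.Ioi 0, F k x := fun k =>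
    setIntegral_congr_fun measurableSet_Ioi fun x hx => Real.norm_of_nonneg
      (mul_nonneg (by positivity) (mul_nonneg (expSlope_pos hx).le (Real.exp_pos _).le))
  have h := hasSum_integral_of_summable_integral_norm (μ := volume.restrict (Set.Ioi 0)) (F := F)
    (fun k => (integral_exp_neg_mul_expSlope k).1.const_mul _)
    (by simp only [hn, hFi]; exact summable_logSeries)
  simp only [hFi] at h
  rw [logSeries, h.tsum_eq]
  refine setIntegral_congr_fun measurableSet_Ioi fun x hx => ?_
  have hx' : 0 < x := hx
  have hs := (Real.hasSum_pow_div_log_of_abs_lt_one (x := Real.exp (-x))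
    (by rw [abs_of_pos (Real.exp_pos _)]; exact exp_neg_lt_one hx')).mul_left (expSlope x)
  rw [hitEntropy, ← hs.tsum_eq]
  refine tsum_congr fun k => ?_
  rw [hF, ← Real.exp_nat_mul]
  push_cast
  ring_nf

theorem integrableOn_hitEntropy : IntegrableOn hitEntropy (Set.Ioi 0) :=
  -- A non-integrable function has integral `0` by convention, which the positive value excludes.
  Integrable.of_integral_ne_zero (by rw [integral_hitEntropy]; exact logSeries_pos.ne')

/-- The singularity at `0` is only logarithmic; this crude power bound integrates to `6 √w` on `(0,
w)`. -/
theorem hitEntropy_le {x : ℝ} (hx : 0 < x) (hx1 : x ≤ 1) :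
    hitEntropy x ≤ 3 * x ^ (-(1 / 2) : ℝ) := by
  have h1 : x / 2 ≤ 1 - Real.exp (-x) := by
    have := Real.add_one_le_exp x
    have h2 : Real.exp (-x) * Real.exp x = 1 := by rw [← Real.exp_add]; simp
    nlinarith [Real.exp_pos (-x)]
  have h2 : -Real.log (1 - Real.exp (-x)) ≤ Real.log (2 / x) := by
    rw [← Real.log_inv]
    refine Real.log_le_log (inv_pos.2 (sub_pos.2 (exp_neg_lt_one hx))) ?_
    rw [← inv_div]
    exact inv_anti₀ (by positivity) h1
  have h3 : Real.log (2 / x) ≤ 3 * x ^ (-(1 / 2) : ℝ) := by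
    refine (Real.log_le_rpow_div (by positivity) (show (0 : ℝ) < 1 / 2 by norm_num)).trans ?_
    rw [Real.div_rpow (by norm_num) hx.le, Real.rpow_neg hx.le, ← Real.sqrt_eq_rpow 2, div_div,
      mul_comm, ← div_div, div_eq_mul_inv _ (x ^ _)]
    have hs : √2 ≤ 3 / 2 := by
      rw [Real.sqrt_le_left (by norm_num)]; norm_num
    exact mul_le_mul_of_nonneg_right (by linarith) (by positivity)
  exact (mul_le_of_le_one_left (neg_log_one_sub_exp_pos hx).le (expSlope_le_one hx)).trans
    (h2.trans h3)

/-- The integral of `hitEntropy` over `(w, ∞)` is close to that over `(0, ∞)` for small `w`. -/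
theorem integral_Ioi_hitEntropy_ge {w : ℝ} (hw : 0 < w) (hw1 : w ≤ 1) :
    logSeries - 6 * √w ≤ ∫ x in Set.Ioi w, hitEntropy x := by
  have h1 := intervalIntegral.integral_Ioi_sub_Ioi integrableOn_hitEntropy hw.le
  have hr : IntervalIntegrable (fun x : ℝ => 3 * x ^ (-(1 / 2) : ℝ)) volume 0 w :=
    (intervalIntegral.intervalIntegrable_rpow' (by norm_num)).const_mul 3
  have h2 : ∫ x in (0 : ℝ)..w, hitEntropy x ≤ ∫ x in (0 : ℝ)..w, 3 * x ^ (-(1 / 2) : ℝ) := by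
    rw [intervalIntegral.integral_of_le hw.le, intervalIntegral.integral_of_le hw.le]
    exact setIntegral_mono_on (integrableOn_hitEntropy.mono_set Set.Ioc_subset_Ioi_self)
      ((intervalIntegrable_iff_integrableOn_Ioc_of_le hw.le).1 hr) measurableSet_Ioc
      fun x hx => hitEntropy_le hx.1 (hx.2.trans hw1)
  rw [intervalIntegral.integral_const_mul, integral_rpow (Or.inl (by norm_num))] at h2
  norm_num at h2
  rw [← Real.sqrt_eq_rpow] at h2
  rw [integral_hitEntropy] at h1
  linarith

/-! ### Comparison under an antitone weight -/

section Weighted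

variable {w u s : ℝ} {g : ℝ → ℝ}

theorem intervalIntegrable_mul_exp_neg (hgc : Continuous g) (a b : ℝ) :
    IntervalIntegrable (fun x => g x * Real.exp (-x)) volume a b :=
  (hgc.mul (by fun_prop)).intervalIntegrable _ _

theorem intervalIntegrable_mul_hitEntropy (hgc : Continuous g) (hw : 0 < w) (hs : w ≤ s) :
    IntervalIntegrable (fun x => g x * hitEntropy x) volume w s := by
  refine (hgc.continuousOn.mul (continuousOn_hitEntropy.mono ?_)).intervalIntegrable
  rw [Set.uIcc_of_le hs]
  exact fun x hx => hw.trans_le hx.1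

/-- An antitone weight gives at least as much weight to `hitEntropy` as to the exponential density,
relative to the total masses on `(w, ∞)`. -/
theorem integral_hitEntropy_mul_le_integral (hw : 0 < w) (hs : w ≤ s) (hgc : Continuous g)
    (hg : AntitoneOn g (Set.Ici 0)) (hg0 : ∀ x, 0 ≤ x → 0 ≤ g x) :
    (∫ x in Set.Ioi w, hitEntropy x) * ∫ x in w..s, g x * Real.exp (-x) ≤
      ∫ x in w..s, g x * hitEntropy x := by
  set c := ∫ x in Set.Ioi w, hitEntropy x with hc
  set r : ℝ → ℝ := fun x => hitEntropy x * Real.exp x with hr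
  have hra : AntitoneOn r (Set.Ioi 0) := hitEntropy_mul_exp_antitoneOn
  have hJw : IntegrableOn hitEntropy (Set.Ioi w) :=
    integrableOn_hitEntropy.mono_set (Set.Ioi_subset_Ioi hw.le)
  have hc0 : 0 ≤ c := setIntegral_nonneg measurableSet_Ioi fun x hx =>
    (hitEntropy_pos (hw.trans hx)).le
  have hf : ∀ x, hitEntropy x - c * Real.exp (-x) = (r x - c) * Real.exp (-x) := by
    intro x
    have : Real.exp x * Real.exp (-x) = 1 := by rw [← Real.exp_add]; simp
    rw [hr, sub_mul, mul_assoc, this, mul_one]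
  have hgJ := intervalIntegrable_mul_hitEntropy hgc hw hs
  have hgE := (intervalIntegrable_mul_exp_neg hgc w s).const_mul c
  have hJ : IntervalIntegrable hitEntropy volume w s := by
    simpa using intervalIntegrable_mul_hitEntropy (continuous_const (y := (1 : ℝ))) hw hs
  have hE : IntervalIntegrable (fun x => c * Real.exp (-x)) volume w s :=
    Continuous.intervalIntegrable (by fun_prop) _ _
  rw [← intervalIntegral.integral_const_mul, ← sub_nonneg, ← intervalIntegral.integral_sub hgJ hgE]
  have hfun : ∀ x, g x * hitEntropy x - c * (g x * Real.exp (-x)) =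
      g x * (hitEntropy x - c * Real.exp (-x)) := fun x => by ring
  simp only [hfun]
  have hs0 : 0 < s := hw.trans_le hs
  -- The sign of `hitEntropy x - c e^{-x}` is that of `r x - c`, which changes at most once, from
  -- plus to minus. Either there is no negative part before `s`, or a crossing point `y` exists.
  rcases le_or_gt c (r s) with hcs | hcs
  · refine intervalIntegral.integral_nonneg hs fun x hx => ?_
    have hx0 : 0 < x := hw.trans_le hx.1
    rw [hf]
    exact mul_nonneg (hg0 x hx0.le) (mul_nonneg
      (sub_nonneg.2 (hcs.trans (hra hx0 hs0 hx.2))) (Real.exp_pos _).le)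
  · obtain ⟨y, hy, hyl, hyr⟩ : ∃ y ∈ Set.Icc w s, (∀ x ∈ Set.Icc w s, x < y → c ≤ r x) ∧
        ∀ x ∈ Set.Icc w s, y ≤ x → r x ≤ c := by
      rcases le_or_gt (r w) c with hwc | hwc
      · exact ⟨w, ⟨le_rfl, hs⟩, fun x hx h => absurd hx.1 h.not_ge,
          fun x hx _ => (hra hw (hw.trans_le hx.1) hx.1).trans hwc⟩
      · have hrc : ContinuousOn r (Set.Icc w s) :=
          (continuousOn_hitEntropy.mul Real.continuous_exp.continuousOn).mono
            fun x hx => hw.trans_le hx.1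
        obtain ⟨y, hy, hyc⟩ := intermediate_value_Icc' hs hrc ⟨hcs.le, hwc.le⟩
        have hy0 : 0 < y := hw.trans_le hy.1
        exact ⟨y, hy, fun x hx h => hyc ▸ hra (hw.trans_le hx.1) hy0 h.le,
          fun x hx h => hyc ▸ hra hy0 (hw.trans_le hx.1) h⟩
    have hy0 : 0 < y := hw.trans_le hy.1
    -- On `(w, ∞)` the difference has mass `c - c e^{-w} ≥ 0`, and beyond `s` it is nonpositive.
    have hmass : 0 ≤ ∫ x in w..s, (hitEntropy x - c * Real.exp (-x)) := by
      have hEw : IntegrableOn (fun x => c * Real.exp (-x)) (Set.Ioi w) := by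
        have := exp_neg_integrableOn_Ioi w one_pos
        simp only [neg_mul, one_mul] at this
        exact this.const_mul c
      have h1 := intervalIntegral.integral_Ioi_sub_Ioi (hJw.sub hEw) hs
      have h2 : ∫ x in Set.Ioi s, (hitEntropy x - c * Real.exp (-x)) ≤ 0 :=
        setIntegral_nonpos measurableSet_Ioi fun x hx => by
          rw [hf]
          exact mul_nonpos_of_nonpos_of_nonneg (sub_nonpos.2
            ((hra hs0 (hs0.trans hx) (le_of_lt hx)).trans hcs.le)) (Real.exp_pos _).le
      have h3 : ∫ x in Set.Ioi w, (hitEntropy x - c * Real.exp (-x)) = c - c * Real.exp (-w) := by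
        rw [integral_sub hJw hEw, integral_const_mul, integral_exp_neg_Ioi]
      have h4 : c * Real.exp (-w) ≤ c := mul_le_of_le_one_right hc0 (exp_neg_lt_one hw).le
      simp only [Pi.sub_apply] at h1
      linarith
    -- Replacing `g x` by `g y` can only lower the integral: `g x ≥ g y` where the difference is
    -- nonnegative, and `g x ≤ g y` where it is nonpositive.
    have hle : ∫ x in w..s, g y * (hitEntropy x - c * Real.exp (-x)) ≤
        ∫ x in w..s, g x * (hitEntropy x - c * Real.exp (-x)) := by
      refine intervalIntegral.integral_mono_on hs ((hJ.sub hE).const_mul _) ?_ fun x hx => ?_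
      · simpa only [hfun] using hgJ.sub hgE
      · have hx0 : 0 < x := hw.trans_le hx.1
        rw [hf]
        rcases lt_or_ge x y with hxy | hxy
        · exact mul_le_mul_of_nonneg_right (hg hx0.le hy0.le hxy.le)
            (mul_nonneg (sub_nonneg.2 (hyl x hx hxy)) (Real.exp_pos _).le)
        · exact mul_le_mul_of_nonpos_right (hg hy0.le hx0.le hxy)
            (mul_nonpos_of_nonpos_of_nonneg (sub_nonpos.2 (hyr x hx hxy)) (Real.exp_pos _).le)
    rw [intervalIntegral.integral_const_mul] at hle
    exact (mul_nonneg (hg0 y hy0.le) hmass).trans hle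

/-- A stretch of length two before `u` outweighs everything after `u`. -/
theorem six_mul_integral_exp_neg_le (hw : 0 < w) (hwu : w + 2 ≤ u) (hs : u ≤ s)
    (hgc : Continuous g) (hg : AntitoneOn g (Set.Ici 0)) (hg0 : ∀ x, 0 ≤ x → 0 ≤ g x) :
    6 * ∫ x in u..s, g x * Real.exp (-x) ≤ ∫ x in w..s, g x * Real.exp (-x) := by
  have hu : 0 < u := by linarith
  have hE : ∀ a b : ℝ, ∫ x in a..b, Real.exp (-x) = Real.exp (-a) - Real.exp (-b) := by
    intro a b
    rw [intervalIntegral.integral_comp_neg fun x => Real.exp x, integral_exp]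
  have hEi : ∀ a b : ℝ, IntervalIntegrable (fun x => g u * Real.exp (-x)) volume a b := fun a b =>
    Continuous.intervalIntegrable (by fun_prop) _ _
  have h1 : ∫ x in w..u, g u * Real.exp (-x) ≤ ∫ x in w..u, g x * Real.exp (-x) :=
    intervalIntegral.integral_mono_on (by linarith) (hEi _ _)
      (intervalIntegrable_mul_exp_neg hgc _ _) fun x hx =>
        mul_le_mul_of_nonneg_right (hg (hw.trans_le hx.1).le hu.le hx.2) (Real.exp_pos _).le
  have h2 : ∫ x in u..s, g x * Real.exp (-x) ≤ ∫ x in u..s, g u * Real.exp (-x) :=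
    intervalIntegral.integral_mono_on hs (intervalIntegrable_mul_exp_neg hgc _ _) (hEi _ _)
      fun x hx =>
        mul_le_mul_of_nonneg_right (hg hu.le (hu.trans_le hx.1).le hx.1) (Real.exp_pos _).le
  rw [intervalIntegral.integral_const_mul, hE] at h1 h2
  have h3 : 7 * Real.exp (-u) ≤ Real.exp (-w) := by
    have h4 : Real.exp (-u) * Real.exp 2 ≤ Real.exp (-w) := by
      rw [← Real.exp_add]; exact Real.exp_le_exp.2 (by linarith)
    have h5 : (7 : ℝ) ≤ Real.exp 2 := by
      have h6 : Real.exp 2 = Real.exp 1 * Real.exp 1 := by rw [← Real.exp_add]; norm_num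
      nlinarith [Real.exp_one_gt_d9]
    nlinarith [Real.exp_pos (-u)]
  rw [← intervalIntegral.integral_add_adjacent_intervals
    (intervalIntegrable_mul_exp_neg hgc w u) (intervalIntegrable_mul_exp_neg hgc u s)]
  have h7 := mul_le_mul_of_nonneg_left h3 (hg0 u hu.le)
  nlinarith [mul_nonneg (hg0 u hu.le) (Real.exp_pos (-s)).le,
    mul_nonneg (hg0 u hu.le) (Real.exp_pos (-u)).le]

theorem integral_exp_neg_nonneg (hu : 0 < u) (hs : u ≤ s) (hg0 : ∀ x, 0 ≤ x → 0 ≤ g x) :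
    0 ≤ ∫ x in u..s, g x * Real.exp (-x) :=
  intervalIntegral.integral_nonneg hs fun x hx =>
    mul_nonneg (hg0 x (hu.trans_le hx.1).le) (Real.exp_pos _).le

/-- Comparison of the entropy of one cell over a window, extended to the left by `K`, with its
state change probability over the window. -/
theorem integral_cell_le {K : ℝ} (hK : 2 ≤ K) (hw : 0 < w) (hs : w * Real.exp K ≤ s)
    (hgc : Continuous g) (hg : AntitoneOn g (Set.Ici 0)) (hg0 : ∀ x, 0 ≤ x → 0 ≤ g x) :
    (1 + logSeries - 12 / K) * ∫ x in (w * Real.exp K)..s, g x * Real.exp (-x) ≤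
      ∫ x in w..s, g x * (Real.exp (-x) + hitEntropy x) := by
  have hK0 : 0 < K := by linarith
  have hwu : w ≤ w * Real.exp K := le_mul_of_one_le_right hw.le (Real.one_le_exp hK0.le)
  have hu : 0 < w * Real.exp K := hw.trans_le hwu
  have hws := hwu.trans hs
  set u := w * Real.exp K with hu_def
  have hX := integral_exp_neg_nonneg hu hs hg0
  have hW := integral_exp_neg_nonneg hw hwu hg0
  have hadd := intervalIntegral.integral_add_adjacent_intervals
    (intervalIntegrable_mul_exp_neg hgc w u) (intervalIntegrable_mul_exp_neg hgc u s)
  have hsplit : ∫ x in w..s, g x * (Real.exp (-x) + hitEntropy x) =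
      (∫ x in w..s, g x * Real.exp (-x)) + ∫ x in w..s, g x * hitEntropy x := by
    simp only [mul_add]
    exact intervalIntegral.integral_add (intervalIntegrable_mul_exp_neg hgc w s)
      (intervalIntegrable_mul_hitEntropy hgc hw hws)
  rw [hsplit]
  have hJ0 : 0 ≤ ∫ x in w..s, g x * hitEntropy x :=
    intervalIntegral.integral_nonneg hws fun x hx =>
      mul_nonneg (hg0 x (hw.trans_le hx.1).le) (hitEntropy_pos (hw.trans_le hx.1)).le
  -- If the extension covers length two in `x`, its exponential mass alone suffices, as `1 +
  -- logSeries ≤ 6`. Otherwise `w (e^K - 1) < 2` forces `w ≤ (2/K)²`, and the loss `6 √w` is at most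
  -- `12 / K`.
  rcases le_or_gt (w + 2) u with h | h
  · have h6 := six_mul_integral_exp_neg_le hw h hs hgc hg hg0
    have : (1 + logSeries - 12 / K) ≤ 6 := by
      have := logSeries_le
      have : 0 < 12 / K := by positivity
      linarith
    nlinarith
  · have hmain := integral_hitEntropy_mul_le_integral hw hws hgc hg hg0
    have hwK : w ≤ (2 / K) ^ 2 := by
      have := Real.quadratic_le_exp_of_nonneg hK0.le
      rw [div_pow, le_div_iff₀ (by positivity)]
      nlinarith
    have hsq : √w ≤ 2 / K := (Real.sqrt_le_left (by positivity)).2 hwK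
    have h2K : 2 / K ≤ 1 := (div_le_one hK0).2 hK
    have hw1 : w ≤ 1 := hwK.trans (pow_le_one₀ (by positivity) h2K)
    have hc := integral_Ioi_hitEntropy_ge hw hw1
    have hc0 : 0 ≤ ∫ x in Set.Ioi w, hitEntropy x :=
      setIntegral_nonneg measurableSet_Ioi fun x hx => (hitEntropy_pos (hw.trans hx)).le
    have hc' : 1 + logSeries - 12 / K ≤ 1 + ∫ x in Set.Ioi w, hitEntropy x := by
      have : 12 / K = 6 * (2 / K) := by ring
      linarith
    have h8 := mul_le_mul_of_nonneg_right hc' hX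
    nlinarith [mul_nonneg hc0 hW]

end Weighted

/-! ### From single cells to the sketch -/

namespace LinearizableSketch

variable {n : ℕ} (S : LinearizableSketch n)

/-- With `x = p * lam`, the outcomes "missed" and "hit" contribute `x e^{-x}` and `x * hitEntropy
x`. -/
theorem cellEntropy_eq {lam p : ℝ} (hlam : 0 < lam) (hp : 0 ≤ p) :
    -(Real.exp (-(lam * p)) * Real.log (Real.exp (-(lam * p))) +
      (1 - Real.exp (-(lam * p))) * Real.log (1 - Real.exp (-(lam * p)))) =
    lam * (p * (Real.exp (-(p * lam)) + hitEntropy (p * lam))) := by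
  rcases hp.eq_or_lt with rfl | hp
  · simp
  · rw [Real.log_exp, hitEntropy, expSlope, mul_comm p lam]
    field_simp
    ring

theorem entropy_mul_log_two {lam : ℝ} (hlam : 0 < lam) :
    S.entropy lam * Real.log 2 * lam⁻¹ = ∑ i, S.freeProb i lam *
      (S.area i * (Real.exp (-(S.area i * lam)) + hitEntropy (S.area i * lam))) := by
  have h2 : Real.log 2 ≠ 0 := (Real.log_pos one_lt_two).ne'
  rw [S.entropy_eq hlam.le, div_mul_cancel₀ _ h2, Finset.sum_mul]
  refine Finset.sum_congr rfl fun i _ => ?_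
  rw [miss, cellEntropy_eq hlam (S.area_nonneg i)]
  field_simp

theorem continuousOn_cellEntropy (i : Fin n) : ContinuousOn (fun lam => S.freeProb i lam *
    (S.area i * (Real.exp (-(S.area i * lam)) + hitEntropy (S.area i * lam)))) (Set.Ioi 0) := by
  refine (S.continuous_freeProb i).continuousOn.mul ?_
  rcases (S.area_nonneg i).eq_or_lt with h | h
  · simp only [← h, zero_mul]
    exact continuousOn_const
  · exact continuousOn_const.mul (ContinuousOn.add (by fun_prop)
      (continuousOn_hitEntropy.comp (by fun_prop) fun x hx => mul_pos h hx))

/-- The substitution `x = p * lam` scales both ends of the extension by `p`, so their ratio remains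
`e^K` for cells of every size. -/
theorem integral_freeProb_mul_le {K : ℝ} (hK : 2 ≤ K) {a b : ℝ} (hab : a ≤ b) (i : Fin n) :
    (1 + logSeries - 12 / K) * ∫ lam in Real.exp a..Real.exp b,
        S.area i * S.miss lam i * S.freeProb i lam ≤
      ∫ lam in Real.exp (a - K)..Real.exp b, S.freeProb i lam *
        (S.area i * (Real.exp (-(S.area i * lam)) + hitEntropy (S.area i * lam))) := by
  rcases (S.area_nonneg i).eq_or_lt with h | hp
  · simp [← h]
  set p := S.area i with hp_def
  set g : ℝ → ℝ := fun x => S.freeProb i (x / p) with hg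
  have hgp : ∀ lam, S.freeProb i lam = g (p * lam) := fun lam => by
    rw [hg]; simp only; rw [mul_div_cancel_left₀ _ hp.ne']
  have hcell := integral_cell_le (w := p * Real.exp (a - K)) (s := p * Real.exp b) (g := g) hK
    (mul_pos hp (Real.exp_pos _))
    (by
      rw [mul_assoc, ← Real.exp_add, sub_add_cancel]
      exact mul_le_mul_of_nonneg_left (Real.exp_le_exp.2 hab) hp.le)
    ((S.continuous_freeProb i).comp (continuous_id.div_const p))
    (fun x hx y hy hxy => S.freeProb_antitoneOn i (div_nonneg hx hp.le) (div_nonneg hy hp.le)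
      (div_le_div_of_nonneg_right hxy hp.le))
    (fun x hx => S.freeProb_nonneg i (div_nonneg hx hp.le))
  rw [mul_assoc p, ← Real.exp_add, sub_add_cancel, ← intervalIntegral.mul_integral_comp_mul_left,
    ← intervalIntegral.mul_integral_comp_mul_left] at hcell
  convert! hcell using 2
  · rw [← intervalIntegral.integral_const_mul]
    refine intervalIntegral.integral_congr fun lam _ => ?_
    simp only [hgp, miss, ← hp_def, mul_comm lam p]
    ring
  · rw [← intervalIntegral.integral_const_mul]
    refine intervalIntegral.integral_congr fun lam _ => ?_
    simp only [hgp]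
    ring

/-- The trade-off between the entropy over `[e^{a-K}, e^b]` and the state change probability over
`[e^a, e^b]`. -/
theorem rate_le_entropy {K a b Hbar Rbar : ℝ} (hK : 12 ≤ K) (hab : a ≤ b)
    (hH : ∀ lam : ℝ, 0 < lam → S.entropy lam ≤ Hbar)
    (hR : ∀ lam ∈ Set.Icc (Real.exp a) (Real.exp b), Rbar ≤ 2 * lam * S.expectedChangeProb lam) :
    (1 + logSeries - 12 / K) * (Rbar / 2 * (b - a)) ≤ Hbar * Real.log 2 * (b - a + K) := by
  have hpos : ∀ {c d x : ℝ}, x ∈ Set.Icc (Real.exp c) (Real.exp d) → 0 < x := fun hx =>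
    (Real.exp_pos _).trans_le hx.1
  have hK0 : 0 < K := by linarith
  -- The bound `12 ≤ K` keeps this coefficient nonnegative, so that the rate bound can be multiplied
  -- by it.
  have hC : 0 ≤ 1 + logSeries - 12 / K := by
    have := logSeries_pos
    have : 12 / K ≤ 1 := (div_le_one hK0).2 hK
    linarith
  have hinv : ∀ {c d : ℝ}, c ≤ d →
      IntervalIntegrable (fun x : ℝ => x⁻¹) volume (Real.exp c) (Real.exp d) := by
    intro c d hcd
    refine ContinuousOn.intervalIntegrable (continuousOn_inv₀.mono fun x hx => ?_)
    rw [Set.uIcc_of_le (Real.exp_le_exp.2 hcd)] at hx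
    exact (hpos hx).ne'
  have hint : ∀ c d : ℝ, ∫ x in Real.exp c..Real.exp d, x⁻¹ = d - c := fun c d => by
    rw [integral_inv_of_pos (Real.exp_pos _) (Real.exp_pos _), ← Real.exp_sub, Real.log_exp]
  have hEc : ∀ i, Continuous fun lam => S.area i * S.miss lam i * S.freeProb i lam := fun i =>
    Continuous.mul (by unfold miss; fun_prop) (S.continuous_freeProb i)
  have h1 : Rbar / 2 * (b - a) ≤
      ∑ i, ∫ lam in Real.exp a..Real.exp b, S.area i * S.miss lam i * S.freeProb i lam := by
    rw [← intervalIntegral.integral_finsetSum fun i _ => (hEc i).intervalIntegrable _ _,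
      ← hint a b, ← intervalIntegral.integral_const_mul]
    refine intervalIntegral.integral_mono_on (Real.exp_le_exp.2 hab) ((hinv hab).const_mul _)
      ((continuous_finsetSum _ fun i _ => hEc i).intervalIntegrable _ _) fun lam hlam => ?_
    have hl := hpos hlam
    rw [← S.expectedChangeProb_eq hl.le, ← div_eq_mul_inv, div_le_iff₀ hl]
    linarith [hR lam hlam]
  have hAb : a - K ≤ b := by linarith
  have hIcc : Set.uIcc (Real.exp (a - K)) (Real.exp b) ⊆ Set.Ioi 0 := fun x hx => by
    rw [Set.uIcc_of_le (Real.exp_le_exp.2 hAb)] at hx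
    exact hpos hx
  have hHi : ∀ i, IntervalIntegrable (fun lam => S.freeProb i lam * (S.area i *
      (Real.exp (-(S.area i * lam)) + hitEntropy (S.area i * lam)))) volume
      (Real.exp (a - K)) (Real.exp b) := fun i =>
    ((S.continuousOn_cellEntropy i).mono hIcc).intervalIntegrable
  have h2 : ∑ i, ∫ lam in Real.exp (a - K)..Real.exp b, S.freeProb i lam * (S.area i *
      (Real.exp (-(S.area i * lam)) + hitEntropy (S.area i * lam))) ≤
      Hbar * Real.log 2 * (b - a + K) := by
    rw [← intervalIntegral.integral_finsetSum fun i _ => hHi i,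
      show b - a + K = b - (a - K) by ring, ← hint (a - K) b,
      ← intervalIntegral.integral_const_mul]
    refine intervalIntegral.integral_mono_on (Real.exp_le_exp.2 hAb)
      ((continuousOn_finsetSum _ fun i _ => (S.continuousOn_cellEntropy i).mono
        hIcc).intervalIntegrable)
      ((hinv hAb).const_mul _) fun lam hlam => ?_
    have hl := hpos hlam
    rw [← S.entropy_mul_log_two hl]
    exact mul_le_mul_of_nonneg_right (mul_le_mul_of_nonneg_right (hH lam hl)
      (Real.log_pos one_lt_two).le) (inv_nonneg.2 hl.le)
  refine (mul_le_mul_of_nonneg_left h1 hC).trans (le_trans ?_ h2)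
  rw [Finset.mul_sum]
  exact Finset.sum_le_sum fun i _ => S.integral_freeProb_mul_le (by linarith) hab i

end LinearizableSketch

/-! ### Constants, asymptotics and the choice of `K` -/

theorem constH0_eq : constH0 = (1 + logSeries) / Real.log 2 := by
  unfold constH0 logSeries Real.logb
  simp only [mul_div_assoc', tsum_div_const]
  ring

theorem constH0_pos : 0 < constH0 := by
  rw [constH0_eq]
  exact div_pos (by linarith [logSeries_pos]) (Real.log_pos one_lt_two)

theorem constI0_pos : 0 < constI0 := by
  unfold constI0; positivity

theorem one_le_coreDenom {d : ℝ} (hd : 0 < d) (hx : 0 ≤ coreNumer d) : 1 ≤ coreDenom d := by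
  have := constH0_pos
  have := constI0_pos
  unfold coreDenom
  exact le_add_of_nonneg_right (by positivity)

theorem coreNumer_nonneg {d : ℝ} (hd : 4096 ≤ d) : 0 ≤ coreNumer d := by
  have h1 : 8 * d ^ (-(1 / 4) : ℝ) ≤ 1 := by
    have h2 : d ^ (-(1 / 4) : ℝ) ≤ (4096 : ℝ) ^ (-(1 / 4) : ℝ) :=
      Real.rpow_le_rpow_of_nonpos (by norm_num) hd (by norm_num)
    -- The threshold is `4096 = 8 ^ 4`, where `8 d^{-1/4}` reaches `1`.
    have h3 : (4096 : ℝ) ^ (-(1 / 4) : ℝ) = 1 / 8 := by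
      rw [show (4096 : ℝ) = 8 ^ (4 : ℝ) by norm_num, ← Real.rpow_mul (by norm_num)]
      norm_num
    linarith
  have h4 : 5 * Real.exp (-d / 2) ≤ 1 := by
    have h5 : Real.exp (-d / 2) * Real.exp (d / 2) = 1 := by
      rw [← Real.exp_add]; simp [neg_div]
    nlinarith [Real.add_one_le_exp (d / 2), Real.exp_pos (-d / 2)]
  exact sub_nonneg.2 (max_le h1 h4)

theorem tendsto_coreNumer : Tendsto coreNumer atTop (𝓝 1) := by
  have h1 : Tendsto (fun d : ℝ => 8 * d ^ (-(1 / 4) : ℝ)) atTop (𝓝 0) := by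
    simpa using (tendsto_rpow_neg_atTop (show (0 : ℝ) < 1 / 4 by norm_num)).const_mul 8
  have h2 : Tendsto (fun d : ℝ => 5 * Real.exp (-d / 2)) atTop (𝓝 0) := by
    have h3 : Tendsto (fun d : ℝ => -d / 2) atTop atBot :=
      tendsto_neg_atTop_atBot.atBot_div_const two_pos
    simpa using (Real.tendsto_exp_atBot.comp h3).const_mul 5
  have h4 := (h1.max h2).const_sub 1
  rw [max_self, sub_zero] at h4
  exact h4

theorem tendsto_coreDenom : Tendsto coreDenom atTop (𝓝 1) := by
  have h1 : Tendsto (fun d : ℝ => 344 * d⁻¹ + 4 * (√d)⁻¹) atTop (𝓝 0) := by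
    simpa using (tendsto_inv_atTop_zero.const_mul 344).add
      ((tendsto_inv_atTop_zero.comp Real.tendsto_sqrt_atTop).const_mul 4)
  have h2 : Tendsto (fun d : ℝ => (344 + 4 * √d) / d) atTop (𝓝 0) := by
    refine h1.congr' ?_
    filter_upwards [eventually_gt_atTop 0] with d hd
    have hs : √d ≠ 0 := (Real.sqrt_pos.2 hd).ne'
    have hq : √d ^ 2 = d := Real.sq_sqrt hd.le
    field_simp
    linear_combination -4 * hq
  have h3 := ((h2.mul_const (constH0 / constI0)).mul tendsto_coreNumer).const_add 1
  rw [zero_mul, zero_mul, add_zero] at h3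
  exact h3

/-- A nonpositive numerator makes the claim trivial. Otherwise the denominator is at least `1`, and
it suffices to prove the bound with `1 - 8 d^{-1/4}` in place of the quotient. -/
theorem core_bound {d Hbar Rbar : ℝ} (hd : 0 < d) (hD : 0 < coreDenom d)
    (hH : 0 < Hbar) (hR : 0 < Rbar)
    (h : ∀ K, 12 ≤ K →
      (1 + logSeries - 12 / K) * (Rbar / 2 * d) ≤ Hbar * Real.log 2 * (d + K)) :
    constH0 / 2 * (coreNumer d / coreDenom d) ≤ Hbar / Rbar := by
  have hH0 := constH0_pos
  rcases le_or_gt (coreNumer d) 0 with hx | hx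
  · exact (mul_nonpos_of_nonneg_of_nonpos (by positivity)
      (div_nonpos_of_nonpos_of_nonneg hx hD.le)).trans (by positivity)
  have hxD : coreNumer d / coreDenom d ≤ coreNumer d :=
    div_le_self hx.le (one_le_coreDenom hd hx.le)
  set q := d ^ (1 / 4 : ℝ) with hq
  have hq0 : 0 < q := Real.rpow_pos_of_pos hd _
  have hxq : coreNumer d ≤ 1 - 8 / q := by
    rw [div_eq_mul_inv, hq, ← Real.rpow_neg hd.le]
    exact sub_le_sub_left (le_max_left _ _) 1
  have hq8 : 8 < q := by
    have : 0 < 1 - 8 / q := hx.trans_le hxq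
    rwa [sub_pos, div_lt_one hq0] at this
  have hdq : d = q ^ 4 := by
    rw [hq, ← Real.rpow_natCast, ← Real.rpow_mul hd.le]; norm_num
  -- The choice `K = √d`; here `q > 8` gives `K > 64`.
  have hK := h (q ^ 2) (by nlinarith)
  have hlog : 0 < Real.log 2 := Real.log_pos one_lt_two
  refine (mul_le_mul_of_nonneg_left (hxD.trans hxq) (by positivity)).trans ?_
  rw [constH0_eq, le_div_iff₀ hR]
  have hL := logSeries_pos
  set L := logSeries
  have e1 : (1 + L - 12 / q ^ 2) * (Rbar / 2 * d) =
      q ^ 2 * (((1 + L) * q ^ 2 - 12) * (Rbar / 2)) := by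
    rw [hdq]; field_simp
  have e2 : Hbar * Real.log 2 * (d + q ^ 2) = q ^ 2 * (Hbar * Real.log 2 * (q ^ 2 + 1)) := by
    rw [hdq]; ring
  rw [e1, e2] at hK
  have hK2 := le_of_mul_le_mul_left hK (by positivity)
  -- The slack `8 q - 1 + 8 / q` exceeds `63`, more than the `12` to be absorbed.
  have hnum : (1 + L) * (1 - 8 / q) * (q ^ 2 + 1) ≤ (1 + L) * q ^ 2 - 12 := by
    have e3 : (1 - 8 / q) * (q ^ 2 + 1) = q ^ 2 + 1 - 8 * q - 8 / q := by field_simp; ring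
    have : 0 < 8 / q := by positivity
    rw [mul_assoc, e3]
    nlinarith
  have h3 : (1 + L) * (1 - 8 / q) * (Rbar / 2) * (q ^ 2 + 1) ≤
      Hbar * Real.log 2 * (q ^ 2 + 1) := by
    nlinarith
  have h4 := le_of_mul_le_mul_right h3 (by positivity)
  calc (1 + L) / Real.log 2 / 2 * (1 - 8 / q) * Rbar
      = (1 + L) * (1 - 8 / q) * (Rbar / 2) / Real.log 2 := by ring
    _ ≤ Hbar := (div_le_iff₀ hlog).2 h4

end

theorem mainTheorem2 :
    (∀ a b : ℝ, 1 < b - a → 0 < coreDenom (b - a) →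
      ∀ Hbar Rbar : ℝ, 0 < Hbar → 0 < Rbar →
      ∀ (n : ℕ) (S : LinearizableSketch n),
        (∀ lam : ℝ, 0 < lam → S.entropy lam ≤ Hbar) →
        (∀ lam ∈ Set.Icc (Real.exp a) (Real.exp b), Rbar ≤ 2 * lam * S.expectedChangeProb lam) →
        constH0 / 2 * (coreNumer (b - a) / coreDenom (b - a)) ≤ Hbar / Rbar) ∧
    (∀ d : ℝ, 4096 ≤ d → 0 < coreDenom d) ∧
    Tendsto (fun d : ℝ => constH0 / 2 * (coreNumer d / coreDenom d)) atTop (𝓝 (constH0 / 2)) := by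
  refine ⟨fun a b hab hD Hbar Rbar hH hR n S hent hrate => ?_, fun d hd => ?_, ?_⟩
  · exact core_bound (by linarith) hD hH hR fun K hK =>
      S.rate_le_entropy hK (by linarith) hent hrate
  · exact one_pos.trans_le (one_le_coreDenom (by linarith) (coreNumer_nonneg hd))
  · simpa using (tendsto_coreNumer.div tendsto_coreDenom one_ne_zero).const_mul (constH0 / 2)
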